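/- Let $p$ be a prime, let $k\ge 1$ be an integer, and let $F$ be a field containing a primitive $p^k$-th root of unity $\zeta_{p^k}$. Let $G_F=\mathrm{Gal}(F_{sep}/F)$ be the absolute Galois group of $F$, let $G_F(p)$ be its maximal pro-$p$ quotient, and let $G_F(p)^{ab}$ be the quotient of $G_F(p)$ by the closure of its commutator subgroup. Suppose that the torsion subgroup $$\mathrm{Tor}(G_F(p)^{ab})=\{\sigma\in G_F(p)^{ab}\mid \sigma^{n}=1\text{ for some integer } n\ge 1\}$$ is closed in $G_F(p)^{ab}$. Then there exist a set $J$, an integer $l\ge 0$, cardinal numbers $m(1),\dots,m(l)$ and integers $s_1,\dots,s_l$ with $k\le s_1<s_2<\cdots<s_l$ such that there is an isomorphism of topological groups $$G_F(p)^{ab}\;\cong\;\prod_{J}\mathbb{Z}_p\;\times\;\prod_{i=1}^{l}\ \prod_{m(i)}\mathbb{Z}/p^{s_i}\mathbb{Z},$$ where $\mathbb{Z}_p$ has its $p$-adic topology, each $\mathbb{Z}/p^{s_i}\mathbb{Z}$ is discrete, and products have the product topology. -/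

import Mathlib

universe u

noncomputable section

/-- The intersection of all open normal subgroups of `p`-power index of a topological group `G`. -/
def proPKernel (p : ℕ) (G : Type*) [Group G] [TopologicalSpace G] : Subgroup G :=
  ⨅ U : {U : OpenNormalSubgroup G // ∃ n : ℕ, (U : Subgroup G).index = p ^ n},
    (U.1 : Subgroup G)

instance proPKernel_normal (p : ℕ) (G : Type*) [Group G] [TopologicalSpace G] :
    (proPKernel p G).Normal :=
  Subgroup.normal_iInf_normal fun U => U.1.isNormal'

/-- The maximal pro-`p` quotient of a profinite group `G`, with the quotient topology. -/
abbrev MaximalProPQuotient (p : ℕ) (G : Type*) [Group G] [TopologicalSpace G] : Type _ :=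
  G ⧸ proPKernel p G

/-- The group `G_F(p)`: the maximal pro-`p` quotient of the absolute Galois group
`Gal(F_sep / F)`, the latter with its Krull topology. -/
abbrev maximalProPGaloisGroup (p : ℕ) (F : Type*) [Field F] : Type _ :=
  MaximalProPQuotient p (Gal(SeparableClosure F/F))

/-- The profinite abelianization `G_F(p)^{ab}`: the quotient of `G_F(p)` by the closure of its
commutator subgroup. -/
abbrev maximalProPGaloisGroupAb (p : ℕ) (F : Type*) [Field F] : Type _ :=
  TopologicalAbelianization (maximalProPGaloisGroup p F)

end

open Topology

/-! Write B additively for G_F(p)^ab. Filter the characters B → ℤ/p by the level ℤ/p^n to which they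
lift. Kummer theory makes every character lift to level p^k (`exists_galois_character_lift`). The
closed torsion subgroup is compact, so Baire bounds its exponent. A character that lifts far enough
therefore kills torsion and factors through a torsion-free quotient. By duality it lifts to ℤ_p
(`exists_level_forall_padicHom_lift`). Hence the filtration is constant after finitely many steps.
Choose nested bases of the filtration and lift each basis character as far as its layer allows, to
some ℤ/p^s or to ℤ_p. These lifts are the coordinates of the isomorphism
(`exists_bijective_hom_prod`). They separate points because any character can be corrected by lifts
of basis characters and the rest divided by p. They are onto because independent characters take
arbitrary values mod p, and compactness allows successive approximation. -/

/-! ### Characters with values in ℚ/ℤ and lifting by one level -/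

/-- Characters extend when valued in the injective group ℚ/ℤ; the embedding brings them back to
`ZMod m`. The value at 1 lets embeddings of different levels be compared. -/
lemma exists_zmod_embedding (m : ℕ) [NeZero m] :
    ∃ ι : ZMod m →+ AddCircle (1 : ℚ), Function.Injective ι ∧ (∀ x, m • x = 0 → ∃ z, ι z = x) ∧
      ι 1 = ((1 / m : ℚ) : AddCircle (1 : ℚ)) := by
  have hm : (m : ℚ) ≠ 0 := by exact_mod_cast NeZero.ne m
  let g : ℤ →+ AddCircle (1 : ℚ) := zmultiplesHom _ ((1 / m : ℚ) : AddCircle (1 : ℚ))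
  have hg : ∀ i : ℤ, g i = ((i / m : ℚ) : AddCircle (1 : ℚ)) := fun i => by
    rw [zmultiplesHom_apply, ← AddCircle.coe_zsmul]
    congr 1
    simp [div_eq_mul_inv]
  have hg0 : g m = 0 := by
    rw [hg]
    rw [Int.cast_natCast, div_self hm]
    exact AddCircle.coe_period 1
  refine ⟨ZMod.lift m ⟨g, hg0⟩, ?_, ?_, ?_⟩
  · rw [ZMod.lift_injective]
    intro i hi
    change g i = 0 at hi
    rw [hg, AddCircle.coe_eq_zero_iff] at hi
    obtain ⟨n, hn⟩ := hi
    rw [ZMod.intCast_zmod_eq_zero_iff_dvd] 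
    refine ⟨n, ?_⟩
    field_simp at hn
    simp at hn
    rw [mul_comm]; exact_mod_cast hn.symm
  · intro x hx
    induction x using QuotientAddGroup.induction_on with
    | H q =>
      change m • ((q : ℚ) : AddCircle (1 : ℚ)) = 0 at hx
      rw [← AddCircle.coe_nsmul, AddCircle.coe_eq_zero_iff] at hx
      obtain ⟨n, hn⟩ := hx
      refine ⟨(n : ZMod m), ?_⟩
      rw [ZMod.lift_coe]
      change g n = _
      rw [hg]
      congr 1
      simp at hn
      rw [hn]; field_simp
  · have := ZMod.lift_coe m ⟨g, hg0⟩ 1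
    rw [Int.cast_one] at this
    rw [this]
    change g 1 = _
    rw [hg]; simp

section
variable {B : Type*} [AddCommGroup B] [TopologicalSpace B] [NonarchimedeanAddGroup B]

/-- An additive map to a finite cyclic group with a given open subgroup in its kernel is
continuous. -/
def zmodHomOfOpen {m : ℕ} (f : B →+ ZMod m) (U : OpenAddSubgroup B) (hU : ∀ u ∈ U, f u = 0) :
    B →L[ℤ] ZMod m where
  toLinearMap := f.toIntLinearMap
  cont := by
    apply continuous_of_continuousAt_zero f.toIntLinearMap
    rw [ContinuousAt, map_zero, nhds_discrete (ZMod m), Filter.tendsto_pure]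
    filter_upwards [U.mem_nhds_zero] with u hu using hU u hu

/-- A character of order dividing `m` that vanishes on an open subgroup takes values in
`ZMod m`. -/
lemma exists_zmodHom_of_character {m : ℕ} [NeZero m] (g : B →+ AddCircle (1 : ℚ))
    (U : OpenAddSubgroup B) (hU : ∀ u ∈ U, g u = 0) (hm : ∀ b, m • g b = 0)
    (ι : ZMod m →+ AddCircle (1 : ℚ)) (hinj : Function.Injective ι)
    (hι : ∀ x, m • x = 0 → ∃ z, ι z = x) :
    ∃ f : B →L[ℤ] ZMod m, ∀ b, ι (f b) = g b := by
  choose f hf using fun b => hι (g b) (hm b)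
  let f' : B →+ ZMod m := AddMonoidHom.mk' f fun a b => hinj (by rw [map_add, hf, hf, hf, map_add])
  exact ⟨zmodHomOfOpen f' U fun u hu => hinj (by
    change ι (f u) = _
    rw [hf, hU u hu, map_zero]), hf⟩

/-- Characters of `ZMod`-type separate the points of a pro-`p` group. -/
lemma exists_zmodHom_ne_zero [T2Space B] (p : ℕ) [Fact p.Prime]
    (hB : ∀ U : OpenAddSubgroup B, ∃ n, ∀ b : B, p ^ n • b ∈ U) {b : B} (hb : b ≠ 0) :
    ∃ (n : ℕ) (f : B →L[ℤ] ZMod (p ^ n)), f b ≠ 0 := by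
  obtain ⟨U, hU⟩ := NonarchimedeanAddGroup.is_nonarchimedean _ (compl_singleton_mem_nhds hb.symm)
  obtain ⟨n, hn⟩ := hB U
  have hbU : (QuotientAddGroup.mk' U.toAddSubgroup b) ≠ 0 := by
    rw [QuotientAddGroup.mk'_apply, Ne, QuotientAddGroup.eq_zero_iff]
    exact fun h => hU h rfl
  obtain ⟨c, hc⟩ := CharacterModule.exists_character_apply_ne_zero_of_ne_zero hbU
  obtain ⟨ι, hinj, hι, -⟩ := exists_zmod_embedding (p ^ n)
  let c' : (B ⧸ U.toAddSubgroup) →+ AddCircle (1 : ℚ) := c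
  have key : ∀ u ∈ U, QuotientAddGroup.mk' U.toAddSubgroup u = 0 := fun u hu =>
    (QuotientAddGroup.eq_zero_iff _).2 hu
  obtain ⟨f, hf⟩ := exists_zmodHom_of_character (c'.comp (QuotientAddGroup.mk' U.toAddSubgroup)) U
    (fun u hu => by rw [AddMonoidHom.comp_apply, key u hu, map_zero])
    (fun b => by rw [← map_nsmul, AddMonoidHom.comp_apply, key _ (hn b), map_zero]) ι hinj hι
  refine ⟨n, f, fun h => hc ?_⟩
  have := hf b
  rw [h, map_zero] at this
  exact this.symm

/-- A homomorphism to `ZMod (p ^ n)` that vanishes on `{b | p • b ∈ C}` lifts to a homomorphism to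
`ZMod (p ^ (n + 1))` that vanishes on the closed subgroup `C`. -/
lemma exists_lift_succ [CompactSpace B] [T2Space B]
    (p : ℕ) [Fact p.Prime] (C : AddSubgroup B) (hC : IsClosed (C : Set B)) {n : ℕ}
    (f : B →L[ℤ] ZMod (p ^ n)) (hf : ∀ b, p • b ∈ C → f b = 0) :
    ∃ g : B →L[ℤ] ZMod (p ^ (n + 1)),
      (∀ b, ZMod.castHom (pow_dvd_pow p n.le_succ) (ZMod (p ^ n)) (g b) = f b) ∧
      ∀ c ∈ C, g c = 0 := by
  -- This compact set misses `C`, so `C` can be enlarged to an open `D` with the same hypothesis on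
  -- `f`. The problem then lives on the discrete group `B ⧸ D`.
  have hK : IsCompact ((fun b : B => p • b) '' (f ⁻¹' {0}ᶜ)) := by
    refine IsCompact.image (IsClosed.isCompact ?_) (continuous_nsmul p)
    exact (isClosed_discrete _).preimage f.continuous
  obtain ⟨V, hV, hVC⟩ := compact_open_separated_add_right hK hC.isOpen_compl (by
    rintro _ ⟨b, hb, rfl⟩ h
    exact hb (hf b h))
  obtain ⟨U, hU⟩ := NonarchimedeanAddGroup.is_nonarchimedean _ hV
  let D : OpenAddSubgroup B := ⟨C ⊔ U.toAddSubgroup,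
    AddSubgroup.isOpen_mono (le_sup_right : U.toAddSubgroup ≤ _) U.isOpen⟩
  have hD : ∀ b, p • b ∈ D → f b = 0 := by
    intro b hb
    by_contra h
    obtain ⟨c, hc, u, hu, hcu⟩ := AddSubgroup.mem_sup.1 (show p • b ∈ C ⊔ U.toAddSubgroup from hb)
    refine hVC (Set.add_mem_add (Set.mem_image_of_mem _ (show b ∈ f ⁻¹' {0}ᶜ from h))
      (hU (neg_mem hu : -u ∈ U))) ?_
    change p • b + -u ∈ C
    rw [← hcu]; simpa using hc
  let q : B →+ B ⧸ D.toAddSubgroup := QuotientAddGroup.mk' _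
  have hq : ∀ b ∈ D, q b = 0 := fun u hu => (QuotientAddGroup.eq_zero_iff _).2 hu
  have hq' : ∀ b, q b = 0 → b ∈ D := fun u hu => (QuotientAddGroup.eq_zero_iff _).1 hu
  let h : B →+ B ⧸ D.toAddSubgroup := p • q
  have hh : ∀ b, h b = q (p • b) := fun b => by simp [h]
  obtain ⟨ι, hinj, hι, hι1⟩ := exists_zmod_embedding (p ^ n)
  obtain ⟨ι', hinj', hι', hι1'⟩ := exists_zmod_embedding (p ^ (n + 1))
  have hker : h.ker ≤ (ι.comp (f : B →+ ZMod (p ^ n))).ker := by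
    intro b hb
    rw [AddMonoidHom.mem_ker, hh] at hb
    change ι (f b) = 0
    rw [hD b (hq' _ hb), map_zero]
  -- `f` defines a character on the image of multiplication by `p` in `B ⧸ D`; an extension of it to
  -- `B ⧸ D` is a `p`-th part of `f`.
  obtain ⟨c, hc⟩ := CharacterModule.dual_surjective_of_injective
    (QuotientAddGroup.kerLift h).toIntLinearMap (QuotientAddGroup.kerLift_injective h)
    (QuotientAddGroup.lift h.ker (ι.comp (f : B →+ ZMod (p ^ n))) hker)
  let c' : (B ⧸ D.toAddSubgroup) →+ AddCircle (1 : ℚ) := c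
  have hc' : ∀ b, c' (q (p • b)) = ι (f b) := fun b => by
    have := DFunLike.congr_fun hc (b : B ⧸ h.ker)
    rw [← hh]
    exact this
  obtain ⟨g, hg⟩ := exists_zmodHom_of_character (m := p ^ (n + 1)) (c'.comp q) D
    (fun u hu => by rw [AddMonoidHom.comp_apply, hq u hu, map_zero])
    (fun b => by
      rw [AddMonoidHom.comp_apply, ← map_nsmul, ← map_nsmul, pow_succ', mul_smul, hc', map_nsmul f, nsmul_eq_mul,
        CharP.cast_eq_zero, zero_mul, map_zero]) ι' hinj' hι'
  refine ⟨g, fun b => hinj ?_, fun u hu => hinj' ?_⟩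
  -- Since p · (1/p^(n+1)) = 1/p^n, reduction of `ZMod` values corresponds to multiplication by `p`
  -- in ℚ/ℤ.
  · rw [← hc', map_nsmul, map_nsmul, ← AddMonoidHom.comp_apply, ← hg]
    generalize g b = x
    obtain ⟨x, rfl⟩ := ZMod.natCast_zmod_surjective x
    rw [map_natCast, ← nsmul_one, ← nsmul_one x, map_nsmul, map_nsmul, hι1, hι1', smul_comm]
    congr 1
    rw [← AddCircle.coe_nsmul]
    congr 1
    have : (p : ℚ) ≠ 0 := by exact_mod_cast (Fact.out : p.Prime).ne_zero
    simp [pow_succ]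
    field_simp
  · rw [hg, map_zero, AddMonoidHom.comp_apply,
      hq u (show u ∈ C ⊔ U.toAddSubgroup from AddSubgroup.mem_sup_left hu), map_zero]

end

/-- Reduction `ZMod n → ZMod m` for `m ∣ n`, as a continuous linear map. -/
def zmodReduction {m n : ℕ} (h : m ∣ n) : ZMod n →L[ℤ] ZMod m where
  toLinearMap := (ZMod.castHom h (ZMod m)).toAddMonoidHom.toIntLinearMap
  cont := continuous_of_discreteTopology

@[simp] lemma zmodReduction_apply {m n : ℕ} (h : m ∣ n) (x : ZMod n) :
    zmodReduction h x = ZMod.castHom h (ZMod m) x := rfl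

lemma castHom_castHom_apply {l m n : ℕ} (h : l ∣ m) (h' : m ∣ n) (x : ZMod n) :
    ZMod.castHom h (ZMod l) (ZMod.castHom h' (ZMod m) x) =
      ZMod.castHom (h.trans h') (ZMod l) x := by
  rw [← RingHom.comp_apply, ZMod.castHom_comp]

lemma castHom_eq_zero_of_nsmul_eq_zero {p : ℕ} [Fact p.Prime] {N m : ℕ} (hm : ¬ p ^ N ∣ m)
    (h : p ∣ p ^ N) {x : ZMod (p ^ N)} (hx : m • x = 0) : ZMod.castHom h (ZMod p) x = 0 := by
  have hp : p.Prime := Fact.out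
  obtain ⟨x, rfl⟩ := ZMod.natCast_zmod_surjective x
  rw [nsmul_eq_mul, ← Nat.cast_mul, ZMod.natCast_eq_zero_iff] at hx
  rw [map_natCast, ZMod.natCast_eq_zero_iff]
  by_contra hpx
  exact hm ((Nat.Coprime.pow_left N ((hp.coprime_iff_not_dvd).2 hpx)).dvd_of_dvd_mul_right hx)

lemma padicInt_exists_of_compatible (p : ℕ) [Fact p.Prime] (a : ∀ n, ZMod (p ^ n))
    (ha : ∀ n, ZMod.castHom (pow_dvd_pow p n.le_succ) (ZMod (p ^ n)) (a (n + 1)) = a n) :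
    ∃ x : ℤ_[p], ∀ n, PadicInt.toZModPow n x = a n := by
  have hi : ∀ i, (p : ℤ) ^ i ∣ ((a (i + 1)).val : ℤ) - ((a i).val : ℤ) := fun i => by
    have := ha i
    rw [← ZMod.natCast_zmod_val (a (i + 1)), ← ZMod.natCast_zmod_val (a i), map_natCast] at this
    rw [← Nat.cast_pow, ← ZMod.intCast_eq_intCast_iff_dvd_sub]
    simpa using this.symm
  refine ⟨PadicInt.ofIntSeq _ (PadicInt.isCauSeq_padicNorm_of_pow_dvd_sub
    (fun n => ((a n).val : ℤ)) p hi), fun n => ?_⟩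
  rw [PadicInt.toZModPow_ofIntSeq_of_pow_dvd_sub _ _ hi]
  simp

lemma padicInt_continuous_of_toZModPow {p : ℕ} [Fact p.Prime] {X : Type*} [TopologicalSpace X]
    {φ : X → ℤ_[p]} (h : ∀ n, Continuous fun x => PadicInt.toZModPow n (φ x)) :
    Continuous φ := by
  rw [continuous_iff_continuousAt]
  intro x
  rw [ContinuousAt, Metric.tendsto_nhds]
  intro ε hε
  obtain ⟨n, hn⟩ := PadicInt.exists_pow_neg_lt p hε
  have h1 := (h n).continuousAt (x := x)
  rw [ContinuousAt, nhds_discrete (ZMod (p ^ n)), Filter.tendsto_pure] at h1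
  filter_upwards [h1] with y hy
  refine lt_of_le_of_lt ?_ hn
  rw [dist_eq_norm, PadicInt.norm_le_pow_iff_mem_span_pow, ← PadicInt.ker_toZModPow,
    RingHom.mem_ker, map_sub, hy, sub_self]

/-! ### Lifting characters to ℤ_p and the role of closed torsion -/

section
variable {B : Type*} [AddCommGroup B] [TopologicalSpace B]

lemma exists_padicHom_of_compatible (p : ℕ) [Fact p.Prime] (f : ∀ n, B →L[ℤ] ZMod (p ^ n))
    (hf : ∀ n b, ZMod.castHom (pow_dvd_pow p n.le_succ) (ZMod (p ^ n)) (f (n + 1) b) = f n b) :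
    ∃ φ : B →L[ℤ] ℤ_[p], ∀ n b, PadicInt.toZModPow n (φ b) = f n b := by
  choose φ hφ using fun b => padicInt_exists_of_compatible p (fun n => f n b) (fun n => hf n b)
  let φ' : B →+ ℤ_[p] := AddMonoidHom.mk' φ fun a b => PadicInt.ext_of_toZModPow.1 fun n => by
    rw [map_add, hφ, hφ, hφ, map_add]
  refine ⟨⟨φ'.toIntLinearMap, padicInt_continuous_of_toZModPow fun n => ?_⟩, fun n b => hφ b n⟩
  exact (f n).continuous.congr fun b => (hφ b n).symm

lemma toZMod_eq_castHom_toZModPow (p : ℕ) [Fact p.Prime] {n : ℕ} (h : p ∣ p ^ n) (x : ℤ_[p]) :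
    ZMod.castHom h (ZMod p) (PadicInt.toZModPow n x) = PadicInt.toZMod x := by
  have : (ZMod.castHom h (ZMod p)).comp (PadicInt.toZModPow n) = PadicInt.toZMod (p := p) := by
    apply ZMod.ringHom_eq_of_ker_eq
    have hle : RingHom.ker ((ZMod.castHom h (ZMod p)).comp (PadicInt.toZModPow (p := p) n)) ≤
        IsLocalRing.maximalIdeal ℤ_[p] :=
      IsLocalRing.le_maximalIdeal (RingHom.ker_ne_top _)
    rw [PadicInt.ker_toZMod]
    refine le_antisymm hle ?_
    rw [PadicInt.maximalIdeal_eq_span_p, Ideal.span_singleton_le_iff_mem, RingHom.mem_ker]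
    simp
  rw [← this, RingHom.comp_apply]

/-- If `B ⧸ C` has no `p`-torsion, then every homomorphism `B → ZMod p` vanishing on `C` lifts
to `ℤ_[p]`. -/
lemma exists_padicHom_lift [NonarchimedeanAddGroup B] [CompactSpace B] [T2Space B]
    (p : ℕ) [Fact p.Prime] (C : AddSubgroup B) (hC : IsClosed (C : Set B))
    (hpC : ∀ b, p • b ∈ C → b ∈ C) (f : B →L[ℤ] ZMod p) (hf : ∀ c ∈ C, f c = 0) :
    ∃ φ : B →L[ℤ] ℤ_[p], ∀ b, PadicInt.toZMod (φ b) = f b := by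
  have step : ∀ n (g : {g : B →L[ℤ] ZMod (p ^ n) // ∀ c ∈ C, g c = 0}),
      ∃ g' : {g : B →L[ℤ] ZMod (p ^ (n + 1)) // ∀ c ∈ C, g c = 0},
        ∀ b, ZMod.castHom (pow_dvd_pow p n.le_succ) (ZMod (p ^ n)) (g'.1 b) = g.1 b :=
    fun n g => by
      obtain ⟨g', h1, h2⟩ := exists_lift_succ p C hC g.1 fun b hb => g.2 b (hpC b hb)
      exact ⟨⟨g', h2⟩, h1⟩
  choose F hF using step
  have h1 : p ^ 1 ∣ p := (pow_one p).dvd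
  let f1 : {g : B →L[ℤ] ZMod (p ^ 1) // ∀ c ∈ C, g c = 0} :=
    ⟨(zmodReduction h1).comp f, fun c hc => by
      rw [ContinuousLinearMap.comp_apply, hf c hc, map_zero]⟩
  let G : ∀ n, {g : B →L[ℤ] ZMod (p ^ (n + 1)) // ∀ c ∈ C, g c = 0} :=
    fun n => Nat.rec f1 (fun n g => F (n + 1) g) n
  -- `G n` has level n + 1, so it is reduced once to give the term of level n.
  obtain ⟨φ, hφ⟩ := exists_padicHom_of_compatible p
    (fun n => (zmodReduction (pow_dvd_pow p n.le_succ)).comp (G n).1) (fun n b => by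
      simp only [ContinuousLinearMap.comp_apply, zmodReduction_apply]
      congr 1
      exact hF (n + 1) (G n) b)
  refine ⟨φ, fun b => ?_⟩
  have hp1 : p ∣ p ^ 1 := (pow_one p).symm.dvd
  rw [← toZMod_eq_castHom_toZModPow p hp1, hφ]
  simp only [ContinuousLinearMap.comp_apply, zmodReduction_apply]
  rw [show G 1 = F 1 f1 from rfl, hF]
  simp only [f1, ContinuousLinearMap.comp_apply, zmodReduction_apply]
  rw [castHom_castHom_apply]
  simp

/-- A compact torsion group has bounded exponent. -/
lemma exists_bounded_exponent_of_isTorsion {A : Type*} [AddCommGroup A] [TopologicalSpace A]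
    [IsTopologicalAddGroup A] [CompactSpace A] [T2Space A] (hA : ∀ a : A, IsOfFinAddOrder a) :
    ∃ m : ℕ, 0 < m ∧ ∀ a : A, m • a = 0 := by
  -- Baire category: these closed subgroups cover `A`, so one is open and has finite index. The
  -- shift to n + 1 excludes multiplication by 0.
  let K : ℕ → AddSubgroup A := fun n => (nsmulAddMonoidHom (α := A) (n + 1)).ker
  have hKc : ∀ n, IsClosed (K n : Set A) := fun n =>
    isClosed_singleton.preimage (continuous_nsmul (n + 1))
  obtain ⟨n, x, hx⟩ := nonempty_interior_of_iUnion_of_closed hKc (by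
    rw [Set.eq_univ_iff_forall]
    intro a
    obtain ⟨n, hn, h⟩ := isOfFinAddOrder_iff_nsmul_eq_zero.1 (hA a)
    refine Set.mem_iUnion.2 ⟨n - 1, ?_⟩
    change (n - 1 + 1) • a = 0
    rwa [Nat.sub_add_cancel hn])
  have hopen : IsOpen (K n : Set A) :=
    AddSubgroup.isOpen_of_mem_nhds _ (mem_interior_iff_mem_nhds.1 hx)
  have : Finite (A ⧸ K n) := AddSubgroup.quotient_finite_of_isOpen (K n) hopen
  have : (K n).FiniteIndex := AddSubgroup.finiteIndex_of_finite_quotient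
  refine ⟨(n + 1) * (K n).index, Nat.mul_pos n.succ_pos (Nat.pos_of_ne_zero this.index_ne_zero),
    fun a => ?_⟩
  rw [mul_smul]
  exact AddSubgroup.nsmul_index_mem (K n) a

/-- If the torsion subgroup `C` is closed, then all homomorphisms `B → ZMod p` which lift to a
fixed level `ZMod (p ^ N)` lift to `ℤ_[p]`. -/
lemma exists_level_forall_padicHom_lift [NonarchimedeanAddGroup B] [CompactSpace B] [T2Space B]
    (p : ℕ) [Fact p.Prime] (C : AddSubgroup B) (hC : IsClosed (C : Set B))
    (hCtor : ∀ b, b ∈ C ↔ IsOfFinAddOrder b) :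
    ∃ N, ∀ n (_ : N ≤ n) (h : p ∣ p ^ n) (f : B →L[ℤ] ZMod (p ^ n)),
      ∃ φ : B →L[ℤ] ℤ_[p], ∀ b, PadicInt.toZMod (φ b) = ZMod.castHom h (ZMod p) (f b) := by
  have hp : p.Prime := Fact.out
  have : CompactSpace C := isCompact_iff_compactSpace.1 hC.isCompact
  obtain ⟨m, hm0, hm⟩ := exists_bounded_exponent_of_isTorsion (A := C) fun a => by
    have := (hCtor a).1 a.2
    rwa [AddSubmonoid.isOfFinAddOrder_coe] at this
  -- The exponent `m` of the torsion serves as level: p^n > n ≥ m, so p^n does not divide `m`, and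
  -- an element of `ZMod (p ^ n)` killed by `m` is 0 mod `p`.
  refine ⟨m, fun n hn h f => ?_⟩
  refine exists_padicHom_lift p C hC (fun b hb => ?_) ((zmodReduction h).comp f) fun c hc => ?_
  · rw [hCtor] at hb ⊢
    exact hb.of_nsmul hp.ne_zero
  · refine castHom_eq_zero_of_nsmul_eq_zero (m := m) (fun hd => ?_) h ?_
    · exact absurd (Nat.le_of_dvd hm0 hd) (not_le.2 (hn.trans_lt (Nat.lt_pow_self hp.one_lt)))
    · have := congrArg Subtype.val (hm ⟨c, hc⟩)
      rw [← map_nsmul, show m • c = 0 from this, map_zero]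

end

lemma exists_nsmul_eq_of_toZMod_eq_zero {p : ℕ} [Fact p.Prime] {x : ℤ_[p]}
    (hx : PadicInt.toZMod x = 0) : ∃ y, x = p • y := by
  rw [← RingHom.mem_ker, PadicInt.ker_toZMod, PadicInt.maximalIdeal_eq_span_p,
    Ideal.mem_span_singleton] at hx
  obtain ⟨y, rfl⟩ := hx
  exact ⟨y, by simp⟩

lemma exists_nsmul_eq_of_castHom_eq_zero {m p : ℕ} (h : p ∣ m) {x : ZMod m}
    (hx : ZMod.castHom h (ZMod p) x = 0) : ∃ y, x = p • y := by
  obtain ⟨x, rfl⟩ := ZMod.intCast_surjective x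
  rw [map_intCast, ZMod.intCast_zmod_eq_zero_iff_dvd] at hx
  obtain ⟨y, rfl⟩ := hx
  exact ⟨(y : ZMod m), by simp⟩

/-- Multiplication by `p` as an embedding `ZMod (p ^ n) → ZMod (p ^ (n + 1))`. -/
lemma exists_zmod_mul_embedding (p : ℕ) [Fact p.Prime] (n : ℕ) :
    ∃ ι : ZMod (p ^ n) →+ ZMod (p ^ (n + 1)), Function.Injective ι ∧ ∀ y, ∃ z, ι z = p • y := by
  let g : ℤ →+ ZMod (p ^ (n + 1)) := zmultiplesHom _ (p : ZMod (p ^ (n + 1)))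
  have hg : ∀ i : ℤ, g i = ((i * p : ℤ) : ZMod (p ^ (n + 1))) := fun i => by
    simp [g]
  have hg0 : g (p ^ n : ℕ) = 0 := by
    rw [hg, ZMod.intCast_zmod_eq_zero_iff_dvd]
    exact ⟨1, by push_cast; ring⟩
  refine ⟨ZMod.lift _ ⟨g, hg0⟩, ?_, fun y => ?_⟩
  · rw [ZMod.lift_injective]
    intro i hi
    change g i = 0 at hi
    have hp : (p : ℤ) ≠ 0 := by exact_mod_cast (Fact.out : p.Prime).ne_zero
    rw [hg, ZMod.intCast_zmod_eq_zero_iff_dvd, pow_succ, Nat.cast_mul] at hi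
    rw [ZMod.intCast_zmod_eq_zero_iff_dvd]
    exact Int.dvd_of_mul_dvd_mul_right hp hi
  · obtain ⟨y, rfl⟩ := ZMod.intCast_surjective y
    refine ⟨(y : ZMod (p ^ n)), ?_⟩
    rw [ZMod.lift_coe]
    change g y = _
    rw [hg]
    push_cast
    rw [nsmul_eq_mul, mul_comm]

/-- A decreasing sequence of subspaces has adapted nested bases. -/
lemma exists_nested_bases {K V : Type*} [DivisionRing K] [AddCommGroup V] [Module K V]
    (l : ℕ) (W : ℕ → Submodule K V) (hW : Antitone W) :
    ∃ T : ℕ → Set V, (∀ i < l, T (i + 1) ⊆ T i) ∧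
      ∀ i ≤ l, LinearIndepOn K id (T i) ∧ Submodule.span K (T i) = W i := by
  induction l generalizing W with
  | zero =>
    obtain ⟨b, hb, -, hspan, hli⟩ := exists_linearIndepOn_extension
      (K := K) (v := (id : V → V)) (linearIndepOn_empty K id) (Set.empty_subset (W 0 : Set V))
    refine ⟨fun _ => b, by simp, fun i hi => ⟨hli, ?_⟩⟩
    obtain rfl : i = 0 := by simpa using hi
    rw [Set.image_id, Set.image_id] at hspan
    exact le_antisymm (Submodule.span_le.2 hb) hspan
  | succ l ih =>
    -- Bases grow from the smallest subspace upwards: induct on the shifted sequence, then extend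
    -- its largest basis to one of `W 0`.
    obtain ⟨T, hT, hT'⟩ := ih (fun i => W (i + 1)) fun i j h => hW (by lia)
    have hsub : T 0 ⊆ (W 0 : Set V) := by
      refine (Submodule.subset_span (R := K)).trans ?_
      rw [(hT' 0 (Nat.zero_le _)).2]
      exact hW (Nat.zero_le 1)
    obtain ⟨b, hb, hTb, hspan, hli⟩ := exists_linearIndepOn_extension
      (hT' 0 (Nat.zero_le _)).1 hsub
    rw [Set.image_id, Set.image_id] at hspan
    refine ⟨fun i => Nat.casesOn i b T, fun i hi => ?_, fun i hi => ?_⟩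
    · cases i with
      | zero => exact hTb
      | succ i => exact hT i (by lia)
    · cases i with
      | zero => exact ⟨hli, le_antisymm (Submodule.span_le.2 hb) hspan⟩
      | succ i => exact hT' i (by lia)

lemma exists_last_mem_of_mem {α : Type*} (T : ℕ → Set α) {l i : ℕ} (hi : i ≤ l) {e : α}
    (he : e ∈ T i) : e ∈ T l ∨ ∃ j : Fin l, i ≤ j ∧ e ∈ T j \ T (j + 1) := by
  induction hi using Nat.decreasingInduction with
  | self => exact Or.inl he
  | of_succ i hi ih =>
    by_cases h : e ∈ T (i + 1)
    · obtain h | ⟨j, hj, h⟩ := ih h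
      · exact Or.inl h
      · exact Or.inr ⟨j, by lia, h⟩
    · exact Or.inr ⟨⟨i, hi⟩, le_rfl, he, h⟩

/-! ### The filtration of characters by liftability -/

section
variable {B : Type*} [AddCommGroup B] [TopologicalSpace B]

/-- The values of `f` are multiples of `p`, and these form a copy of `ZMod (p ^ n)`. This lowers the
level in the induction proving injectivity. -/
lemma exists_zmodHom_div (p : ℕ) [Fact p.Prime] {n : ℕ} (h : p ∣ p ^ (n + 1))
    (f : B →L[ℤ] ZMod (p ^ (n + 1))) (hf : ∀ b, ZMod.castHom h (ZMod p) (f b) = 0) :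
    ∃ g : B →L[ℤ] ZMod (p ^ n), ∀ b, g b = 0 → f b = 0 := by
  obtain ⟨ι, hinj, hι⟩ := exists_zmod_mul_embedding p n
  have hex : ∀ b, ∃ z, ι z = f b := fun b => by
    obtain ⟨y, hy⟩ := exists_nsmul_eq_of_castHom_eq_zero h (hf b)
    rw [hy]; exact hι y
  have hg : ∀ b, ι (Function.invFun ι (f b)) = f b := fun b => Function.invFun_eq (hex b)
  let g : B →+ ZMod (p ^ n) := AddMonoidHom.mk' (fun b => Function.invFun ι (f b)) fun a b =>
    hinj (by rw [hg, map_add, map_add, hg, hg])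
  refine ⟨⟨g.toIntLinearMap, (continuous_of_discreteTopology
    (f := Function.invFun ι)).comp f.continuous⟩, fun b hb => ?_⟩
  rw [← hg b]
  change Function.invFun ι (f b) = 0 at hb
  rw [hb, map_zero]

/-- The homomorphisms `B → ZMod p` which lift to a homomorphism `B → ZMod (p ^ (n + 1))`
vanishing on `S`. -/
def liftableHoms (B : Type*) [AddCommGroup B] [TopologicalSpace B] (p n : ℕ) [Fact p.Prime]
    (S : Set B) : Submodule (ZMod p) (B →L[ℤ] ZMod p) where
  carrier := {χ | ∃ f : B →L[ℤ] ZMod (p ^ (n + 1)), (∀ b ∈ S, f b = 0) ∧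
    ∀ b, ZMod.castHom (dvd_pow_self p n.succ_ne_zero) (ZMod p) (f b) = χ b}
  zero_mem' := ⟨0, by simp, by simp⟩
  add_mem' := by
    rintro χ χ' ⟨f, hS, hf⟩ ⟨f', hS', hf'⟩
    refine ⟨f + f', fun b hb => ?_, fun b => ?_⟩
    · rw [add_apply, hS b hb, hS' b hb, add_zero]
    · rw [add_apply, add_apply, map_add, hf, hf']
  smul_mem' := by
    rintro c χ ⟨f, hS, hf⟩
    refine ⟨c.val • f, fun b hb => ?_, fun b => ?_⟩
    · rw [smul_apply, hS b hb, smul_zero]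
    · rw [smul_apply, smul_apply, map_nsmul, hf,
        nsmul_eq_mul, ZMod.natCast_zmod_val, smul_eq_mul]

lemma mem_liftableHoms {p n : ℕ} [Fact p.Prime] {S : Set B} {χ : B →L[ℤ] ZMod p} :
    χ ∈ liftableHoms B p n S ↔ ∃ f : B →L[ℤ] ZMod (p ^ (n + 1)), (∀ b ∈ S, f b = 0) ∧
      ∀ b, ZMod.castHom (dvd_pow_self p n.succ_ne_zero) (ZMod p) (f b) = χ b := Iff.rfl

lemma mem_liftableHoms_of_lift {p m n : ℕ} [Fact p.Prime] (h : m ≤ n) {S : Set B}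
    {χ : B →L[ℤ] ZMod p} (f : B →L[ℤ] ZMod (p ^ (n + 1))) (hS : ∀ b ∈ S, f b = 0)
    (hf : ∀ b, ZMod.castHom (dvd_pow_self p n.succ_ne_zero) (ZMod p) (f b) = χ b) :
    χ ∈ liftableHoms B p m S :=
  ⟨(zmodReduction (pow_dvd_pow p (Nat.succ_le_succ h))).comp f,
    fun b hb => by rw [ContinuousLinearMap.comp_apply, hS b hb, map_zero], fun b => by
      rw [ContinuousLinearMap.comp_apply, zmodReduction_apply, castHom_castHom_apply, hf]⟩

lemma liftableHoms_antitone (p : ℕ) [Fact p.Prime] (S : Set B) :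
    Antitone fun n => liftableHoms B p n S := fun _ _ h _ ⟨f, hS, hf⟩ =>
  mem_liftableHoms_of_lift h f hS hf

lemma padicInt_continuous_toZModPow (p n : ℕ) [Fact p.Prime] :
    Continuous (PadicInt.toZModPow n : ℤ_[p] → ZMod (p ^ n)) := by
  apply continuous_of_continuousAt_zero (PadicInt.toZModPow n : ℤ_[p] →+* ZMod (p ^ n))
  rw [ContinuousAt, map_zero, nhds_discrete (ZMod (p ^ n)), Filter.tendsto_pure]
  have hp : (0 : ℝ) < (p : ℝ) ^ (-n : ℤ) :=
    zpow_pos (by exact_mod_cast (Fact.out : p.Prime).pos) _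
  filter_upwards [Metric.closedBall_mem_nhds (0 : ℤ_[p]) hp] with x hx
  rw [mem_closedBall_zero_iff, PadicInt.norm_le_pow_iff_mem_span_pow,
    ← PadicInt.ker_toZModPow] at hx
  exact hx

lemma mem_liftableHoms_of_padicLift {p : ℕ} (n : ℕ) [Fact p.Prime] {S : Set B}
    {χ : B →L[ℤ] ZMod p} (φ : B →L[ℤ] ℤ_[p]) (hS : ∀ b ∈ S, φ b = 0)
    (hφ : ∀ b, PadicInt.toZMod (φ b) = χ b) : χ ∈ liftableHoms B p n S :=
  ⟨⟨((PadicInt.toZModPow (n + 1)).toAddMonoidHom.toIntLinearMap).comp φ.toLinearMap,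
      (padicInt_continuous_toZModPow p (n + 1)).comp φ.continuous⟩,
    fun b hb => by
      change PadicInt.toZModPow (n + 1) (φ b) = 0
      rw [hS b hb, map_zero], fun b => by
      rw [← hφ, ← toZMod_eq_castHom_toZModPow p (dvd_pow_self p n.succ_ne_zero)]
      rfl⟩

/-- If every homomorphism `B → ZMod p` that lifts to `ZMod (p ^ n)` has a lift vanishing at `b`,
then all homomorphisms `B → ZMod (p ^ n)` vanish at `b`. -/
lemma zmodHom_apply_eq_zero_of_liftableHoms_le (p : ℕ) [Fact p.Prime] (b : B)
    (h : ∀ n, liftableHoms B p n ∅ ≤ liftableHoms B p n {b}) (n : ℕ) (f : B →L[ℤ] ZMod (p ^ n)) :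
    f b = 0 := by
  induction n with
  | zero =>
    have : Subsingleton (ZMod (p ^ 0)) := by rw [pow_zero]; infer_instance
    exact Subsingleton.elim _ _
  | succ n ih =>
    have hp := dvd_pow_self p n.succ_ne_zero
    -- Subtracting a lift of the same character that vanishes at `b` leaves a map divisible by `p`.
    obtain ⟨f', hb, hf'⟩ := h n (show (zmodReduction hp).comp f ∈ liftableHoms B p n ∅ from
      ⟨f, by simp, fun b => rfl⟩)
    obtain ⟨g, hg⟩ := exists_zmodHom_div p hp (f - f') fun x => by
      rw [sub_apply, map_sub, hf', sub_eq_zero]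
      rfl
    have := hg b (ih g)
    rwa [sub_apply, hb b rfl, sub_zero] at this

/-- Linearly independent homomorphisms from a compact group to `ZMod p` have independent values. -/
lemma exists_forall_apply_eq_of_linearIndependent [IsTopologicalAddGroup B] [CompactSpace B]
    {p : ℕ} [Fact p.Prime] {ι : Type*} (χ : ι → B →L[ℤ] ZMod p)
    (hχ : LinearIndependent (ZMod p) χ) (x : ι → ZMod p) : ∃ b, ∀ i, χ i b = x i := by
  classical
  have hfin : ∀ s : Finset ι, ∃ b, ∀ i ∈ s, χ i b = x i := by
    intro s
    let R : AddSubgroup (s → ZMod p) :=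
      (AddMonoidHom.mk' (fun b (i : s) => χ i b) fun a b => by ext; simp).range
    let R' : Submodule (ZMod p) (s → ZMod p) := AddSubgroup.toZModSubmodule p R
    have hR : R' = ⊤ := by
      by_contra hne
      -- A functional killing the set of attained values is a linear relation among the χ i.
      obtain ⟨f, hf0, hf⟩ := Submodule.exists_le_ker_of_lt_top R' (lt_top_iff_ne_top.2 hne)
      have hsum : ∑ i : s, f (Pi.single i 1) • χ i = 0 := by
        ext b
        have h1 : f (fun i : s => χ i b) = 0 := hf (show _ ∈ R from ⟨b, rfl⟩)
        rw [LinearMap.pi_apply_eq_sum_univ f] at h1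
        rw [sum_apply, zero_apply, ← h1]
        refine Finset.sum_congr rfl fun i _ => ?_
        rw [smul_apply, smul_eq_mul, smul_eq_mul, mul_comm]
        congr 2
        ext j
        simp [Pi.single_apply, eq_comm]
      have h0 := Fintype.linearIndependent_iff.1 (hχ.comp ((↑) : s → ι) Subtype.val_injective)
        (fun i => f (Pi.single i 1)) hsum
      refine hf0 (LinearMap.pi_ext' fun i => LinearMap.ext_ring ?_)
      simpa using h0 i
    obtain ⟨b, hb⟩ : (fun i : s => x i) ∈ R := by
      change _ ∈ R'
      rw [hR]; trivial
    exact ⟨b, fun i hi => congrFun hb ⟨i, hi⟩⟩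
  obtain ⟨b, hb⟩ := CompactSpace.iInter_nonempty (t := fun i => χ i ⁻¹' {x i})
    (fun i => (isClosed_discrete _).preimage (χ i).continuous) fun s => by
      obtain ⟨b, hb⟩ := hfin s
      exact ⟨b, Set.mem_iInter₂.2 hb⟩
  exact ⟨b, fun i => Set.mem_iInter.1 hb i⟩

/-- A continuous homomorphism of compact groups which is surjective modulo `p` is surjective, if
the target has no nonzero infinitely `p`-divisible elements. -/
lemma surjective_of_surjective_mod [CompactSpace B] {P : Type*} [AddCommGroup P]
    [TopologicalSpace P] [IsTopologicalAddGroup P] [CompactSpace P] [T2Space P] (p : ℕ)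
    (hP : ∀ x : P, (∀ M : ℕ, ∃ y, x = p ^ M • y) → x = 0) (Φ : B →L[ℤ] P)
    (hΦ : ∀ x, ∃ b y, x = Φ b + p • y) : Function.Surjective Φ := by
  intro x
  let D : ℕ → Set P := fun M => Set.range fun y : P => p ^ M • y
  have hDc : ∀ M, IsClosed (D M) := fun M => (isCompact_range (continuous_nsmul (p ^ M))).isClosed
  -- Solutions modulo p^M form a decreasing sequence of nonempty compact sets; a common point solves
  -- the equation exactly.
  let E : ℕ → Set B := fun M => {b | x - Φ b ∈ D M}
  have hEc : ∀ M, IsClosed (E M) := fun M =>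
    (hDc M).preimage (continuous_const.sub Φ.continuous)
  have hE : ∀ M, (E M).Nonempty := by
    intro M
    induction M with
    | zero => exact ⟨0, x, by simp⟩
    | succ M ih =>
      obtain ⟨b, y, hy⟩ := ih
      obtain ⟨b', z, hz⟩ := hΦ y
      refine ⟨b + p ^ M • b', z, ?_⟩
      change p ^ M • y = x - Φ b at hy
      change p ^ (M + 1) • z = x - Φ (b + p ^ M • b')
      rw [map_add, ← sub_sub, ← hy, map_nsmul, ← nsmul_sub, pow_succ, mul_smul]
      congr 1
      rw [hz, add_sub_cancel_left]
  obtain ⟨b, hb⟩ := IsCompact.nonempty_iInter_of_sequence_nonempty_isCompact_isClosed E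
    (fun M b => by
      rintro ⟨y, hy⟩
      refine ⟨p • y, ?_⟩
      rw [← hy]
      change p ^ M • p • y = p ^ (M + 1) • y
      rw [pow_succ, mul_smul]) hE (hEc 0).isCompact hEc
  refine ⟨b, (sub_eq_zero.1 (hP (x - Φ b) fun M => ?_)).symm⟩
  obtain ⟨y, hy⟩ := Set.mem_iInter.1 hb M
  exact ⟨y, hy.symm⟩

end

/-! ### The structure theorem for abelian pro-p groups -/

lemma eq_zero_of_forall_exists_eq_pow_nsmul (p : ℕ) [Fact p.Prime] {J : Type*} {l : ℕ}
    {m : Fin l → Type*} {s : Fin l → ℕ} (x : (J → ℤ_[p]) × ((i : Fin l) → m i → ZMod (p ^ s i)))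
    (hx : ∀ M : ℕ, ∃ y, x = p ^ M • y) : x = 0 := by
  refine Prod.ext (funext fun j => PadicInt.ext_of_toZModPow.1 fun n => ?_)
    (funext fun i => funext fun e => ?_)
  · obtain ⟨y, rfl⟩ := hx n
    change PadicInt.toZModPow n (p ^ n • y.1 j) = PadicInt.toZModPow n 0
    rw [map_zero, map_nsmul, nsmul_eq_mul, ZMod.natCast_self, zero_mul]
  · obtain ⟨y, rfl⟩ := hx (s i)
    change p ^ s i • y.2 i e = 0
    rw [nsmul_eq_mul, ZMod.natCast_self, zero_mul]

/-- Structure of abelian pro-`p` groups with closed torsion subgroup such that all homomorphisms to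
`ZMod p` lift to `ZMod (p ^ (k + 1))`. -/
theorem exists_bijective_hom_prod (B : Type u) [AddCommGroup B] [TopologicalSpace B]
    [NonarchimedeanAddGroup B] [CompactSpace B] [T2Space B] (p : ℕ) [Fact p.Prime]
    (hB : ∀ U : OpenAddSubgroup B, ∃ n, ∀ b : B, p ^ n • b ∈ U)
    (C : AddSubgroup B) (hC : IsClosed (C : Set B)) (hCtor : ∀ b, b ∈ C ↔ IsOfFinAddOrder b)
    (k : ℕ) (hk : ∀ χ : B →L[ℤ] ZMod p, χ ∈ liftableHoms B p k ∅) :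
    ∃ (J : Type u) (l : ℕ) (m : Fin l → Type u) (s : Fin l → ℕ),
      StrictMono s ∧ (∀ i, k + 1 ≤ s i) ∧
      ∃ Φ : B →L[ℤ] (J → ℤ_[p]) × ((i : Fin l) → m i → ZMod (p ^ s i)), Function.Bijective Φ := by
  obtain ⟨l, hl⟩ := exists_level_forall_padicHom_lift p C hC hCtor
  obtain ⟨T, hT, hTW⟩ := exists_nested_bases l (fun i => liftableHoms B p (k + i) ∅)
    fun i j h => liftableHoms_antitone p ∅ (Nat.add_le_add_left h k)
  have hTmem : ∀ i ≤ l, ∀ e ∈ T i, e ∈ liftableHoms B p (k + i) ∅ := fun i hi e he => by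
    rw [← (hTW i hi).2]
    exact Submodule.subset_span he
  have hφ : ∀ e : T l, ∃ φ : B →L[ℤ] ℤ_[p], ∀ b, PadicInt.toZMod (φ b) = e.1 b := fun e => by
    obtain ⟨f, -, hf⟩ := mem_liftableHoms.1 (hTmem l le_rfl e e.2)
    obtain ⟨φ, hφ⟩ := hl (k + l + 1) (by lia) (dvd_pow_self p (k + l).succ_ne_zero) f
    exact ⟨φ, fun b => by rw [hφ, hf]⟩
  have hF : ∀ (i : Fin l) (e : ↥(T i \ T (i + 1))), ∃ f : B →L[ℤ] ZMod (p ^ (k + i + 1)),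
      ∀ b, ZMod.castHom (dvd_pow_self p (k + i : ℕ).succ_ne_zero) (ZMod p) (f b) = e.1 b :=
    fun i e => by
      obtain ⟨f, -, hf⟩ := mem_liftableHoms.1 (hTmem i i.2.le e e.2.1)
      exact ⟨f, hf⟩
  choose φ hφ using hφ
  choose F hF using hF
  have hanti : ∀ i j, i ≤ j → j ≤ l → T j ⊆ T i := fun i j hij => by
    induction j, hij using Nat.le_induction with
    | base => exact fun _ => le_rfl
    | succ j hij ih => exact fun hj => (hT j (by lia)).trans (ih (by lia))
  let Φ : B →L[ℤ] (T l → ℤ_[p]) × ((i : Fin l) → ↥(T i \ T (i + 1)) → ZMod (p ^ (k + i + 1))) :=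
    (ContinuousLinearMap.pi φ).prod (ContinuousLinearMap.pi fun i => ContinuousLinearMap.pi (F i))
  have hΦ1 : ∀ b e, (Φ b).1 e = φ e b := fun _ _ => rfl
  have hΦ2 : ∀ b i e, (Φ b).2 i e = F i e b := fun _ _ _ => rfl
  refine ⟨T l, l, fun i => ↥(T i \ T (i + 1)), fun i => k + i + 1, fun i j h => ?_, fun i => ?_,
    Φ, ?_, ?_⟩
  · have : (i : ℕ) < j := h
    change k + i + 1 < k + j + 1
    lia
  · change k + 1 ≤ k + i + 1
    lia
  · refine (injective_iff_map_eq_zero Φ).2 fun b hb => ?_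
    by_contra hne
    obtain ⟨n, f, hf⟩ := exists_zmodHom_ne_zero p hB hne
    refine hf (zmodHom_apply_eq_zero_of_liftableHoms_le p b (fun n χ hχ => ?_) n f)
    -- Basis characters of step `i` must have coordinate lifts reaching level n + 1. Those in layer
    -- j ≥ i reach k + j + 1; those in `T l` lift to ℤ_p, so i = l suffices for large n.
    obtain ⟨i, hi, hn, hW⟩ : ∃ i ≤ l, (i = l ∨ n ≤ k + i) ∧ χ ∈ liftableHoms B p (k + i) ∅ := by
      rcases le_or_gt n k with h | h
      · exact ⟨0, Nat.zero_le _, Or.inr (by lia), hk χ⟩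
      · rcases le_total (n - k) l with h' | h'
        · exact ⟨n - k, h', Or.inr (by lia), by rwa [Nat.add_sub_cancel' h.le]⟩
        · exact ⟨l, le_rfl, Or.inl rfl, liftableHoms_antitone p ∅ (by lia) hχ⟩
    rw [← (hTW i hi).2] at hW
    refine Submodule.span_le.2 (fun e he => ?_) hW
    rcases exists_last_mem_of_mem T hi he with h | ⟨j, hij, h⟩
    · refine mem_liftableHoms_of_padicLift n (φ ⟨e, h⟩) (fun c hc => ?_) (hφ ⟨e, h⟩)
      rw [Set.mem_singleton_iff.1 hc, ← hΦ1, hb]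
      rfl
    · refine mem_liftableHoms_of_lift (by have := j.2; lia) (F j ⟨e, h⟩) (fun c hc => ?_)
        (hF j ⟨e, h⟩)
      rw [Set.mem_singleton_iff.1 hc, ← hΦ2, hb]
      rfl
  · refine surjective_of_surjective_mod p (eq_zero_of_forall_exists_eq_pow_nsmul p) Φ fun x => ?_
    -- The layers and `T l` are disjoint parts of the basis `T 0`, so the reductions mod `p` of all
    -- coordinates are independent.
    let χ : T l ⊕ (Σ i : Fin l, ↥(T i \ T (i + 1))) → T 0 :=
      Sum.elim (fun e => ⟨e, hanti 0 l (Nat.zero_le _) le_rfl e.2⟩)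
        fun e => ⟨e.2, hanti 0 e.1 (Nat.zero_le _) e.1.2.le e.2.2.1⟩
    have hdisj : ∀ (i j : Fin l) (a b : B →L[ℤ] ZMod p), a ∈ T i \ T (i + 1) →
        b ∈ T j → a = b → j ≤ i := fun i j a b ha hb hab => by
      by_contra h
      exact ha.2 (hab ▸ hanti (i + 1) j (by have : (i : ℕ) < j := not_le.1 h; lia) j.2.le hb)
    have hχinj : Function.Injective χ := by
      rintro (⟨a, ha⟩ | ⟨i, a, ha⟩) (⟨b, hb⟩ | ⟨j, b, hb⟩) hab <;>
        obtain rfl : a = b := congrArg Subtype.val hab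
      · rfl
      · exact (hb.2 (hanti (j + 1) l (by lia) le_rfl ha)).elim
      · exact (ha.2 (hanti (i + 1) l (by lia) le_rfl hb)).elim
      · obtain rfl : i = j := le_antisymm (hdisj j i a a hb ha.1 rfl) (hdisj i j a a ha hb.1 rfl)
        rfl
    have hli : LinearIndependent (ZMod p) fun a => (χ a : B →L[ℤ] ZMod p) :=
      (hTW 0 (Nat.zero_le _)).1.comp χ hχinj
    obtain ⟨b, hb⟩ := exists_forall_apply_eq_of_linearIndependent _ hli
      (Sum.elim (fun e => PadicInt.toZMod (x.1 e)) fun e =>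
        ZMod.castHom (dvd_pow_self p (k + e.1 : ℕ).succ_ne_zero) (ZMod p) (x.2 e.1 e.2))
    have h1 : ∀ e, ∃ y, x.1 e - φ e b = p • y := fun e => by
      refine exists_nsmul_eq_of_toZMod_eq_zero ?_
      rw [map_sub, hφ, sub_eq_zero]
      exact (hb (Sum.inl e)).symm
    have h2 : ∀ i e, ∃ y, x.2 i e - F i e b = p • y := fun i e => by
      refine exists_nsmul_eq_of_castHom_eq_zero (dvd_pow_self p (k + i : ℕ).succ_ne_zero) ?_
      rw [map_sub, hF, sub_eq_zero]
      exact (hb (Sum.inr ⟨i, e⟩)).symm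
    choose y1 hy1 using h1
    choose y2 hy2 using h2
    refine ⟨b, (y1, y2), Prod.ext (funext fun e => ?_) (funext fun i => funext fun e => ?_)⟩
    · exact (sub_eq_iff_eq_add'.1 (hy1 e))
    · exact (sub_eq_iff_eq_add'.1 (hy2 i e))

/-! ### Kummer theory -/

/-- Hilbert 90 for characters of the Galois group with values in the base field. -/
lemma exists_forall_apply_eq_character_mul {F K : Type*} [Field F] [Field K] [Algebra F K]
    [IsGalois F K] (ρ : Gal(K/F) →* Fˣ) (hρ : IsOpen (ρ.ker : Set Gal(K/F))) :
    ∃ β : K, β ≠ 0 ∧ ∀ σ : Gal(K/F), σ β = algebraMap F K (ρ σ) * β := by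
  let H : ClosedSubgroup Gal(K/F) := ⟨ρ.ker, Subgroup.isClosed_of_isOpen _ hρ⟩
  let E : IntermediateField F K := IntermediateField.fixedField H.1
  have hE : E.fixingSubgroup = ρ.ker := InfiniteGalois.fixingSubgroup_fixedField H
  obtain ⟨hfin, hgal⟩ := (InfiniteGalois.isOpen_and_normal_iff_finite_and_isGalois E).1
    ⟨by rw [hE]; exact hρ, by rw [hE]; infer_instance⟩
  have hsurj := AlgEquiv.restrictNormalHom_surjective (F := F) (K₁ := E) K
  choose lift hlift using hsurj
  have hρE : ∀ σ τ : Gal(K/F), AlgEquiv.restrictNormalHom E σ = AlgEquiv.restrictNormalHom E τ →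
      ρ σ = ρ τ := fun σ τ h => by
    have h1 : σ * τ⁻¹ ∈ (AlgEquiv.restrictNormalHom (F := F) (K₁ := K) E).ker := by
      rw [MonoidHom.mem_ker, map_mul, map_inv, h, mul_inv_cancel]
    rw [IntermediateField.restrictNormalHom_ker, hE, MonoidHom.mem_ker, map_mul, map_inv,
      mul_inv_eq_one] at h1
    exact h1
  -- `ρ` factors through the finite group Gal(E/F). Its values are Galois-invariant, so being a
  -- homomorphism makes it a 1-cocycle.
  let f : Gal(E/F) → Eˣ := fun τ => Units.map (algebraMap F E) (ρ (lift τ))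
  have hf : groupCohomology.IsMulCocycle₁ f := fun σ τ => by
    have h1 : ρ (lift (σ * τ)) = ρ (lift σ) * ρ (lift τ) := by
      rw [← map_mul]
      exact hρE _ _ (by rw [map_mul, hlift, hlift, hlift])
    have h2 : σ • f τ = f τ := Units.ext (σ.commutes _)
    rw [h2, mul_comm]
    simp only [f, h1, map_mul]
  obtain ⟨β, hβ⟩ := groupCohomology.isMulCoboundary₁_of_isMulCocycle₁_of_aut_to_units f hf
  refine ⟨(β : E), by simp, fun σ => ?_⟩
  have h1 := hβ (AlgEquiv.restrictNormalHom E σ)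
  rw [div_eq_iff_eq_mul] at h1
  have h2 := congrArg (fun u : Eˣ => ((u : E) : K)) h1
  simp only [f, hρE _ σ (hlift _)] at h2
  rw [← AlgEquiv.restrictNormalHom_apply E σ β.1]
  exact h2

lemma IsPrimitiveRoot.pow_eq_pow_iff_natCast_eq {M : Type*} [CommMonoid M] {z : M} {n : ℕ}
    (hn : n ≠ 0) (hz : IsPrimitiveRoot z n) (a b : ℕ) : z ^ a = z ^ b ↔ (a : ZMod n) = b := by
  have h := hz.isUnit_unit hn
  rw [ZMod.natCast_eq_natCast_iff]
  have h1 := pow_eq_pow_iff_modEq (x := (hz.isUnit hn).unit) (n := a) (m := b)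
  rw [← h.eq_orderOf] at h1
  rw [← h1, Units.ext_iff]
  simp

/-- By Kummer theory, in presence of a primitive `p ^ k`-th root of unity, every character of the
absolute Galois group of order `p` is divisible by `p ^ (k - 1)`. -/
lemma exists_galois_character_lift {p : ℕ} [Fact p.Prime] {F K : Type*} [Field F] [Field K]
    [Algebra F K] [IsGalois F K] [IsSepClosed K] {k : ℕ} {ζ : F}
    (hζ : IsPrimitiveRoot ζ (p ^ (k + 1))) (χ : Gal(K/F) →* Multiplicative (ZMod p))
    (hχ : IsOpen (χ.ker : Set Gal(K/F))) :
    ∃ ψ : Gal(K/F) →* Multiplicative (ZMod (p ^ (k + 1))),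
      IsOpen (ψ.ker : Set Gal(K/F)) ∧
      ∀ σ, ZMod.castHom (dvd_pow_self p k.succ_ne_zero) (ZMod p) (ψ σ).toAdd = (χ σ).toAdd := by
  have hp : p.Prime := Fact.out
  have hω : IsPrimitiveRoot (ζ ^ p ^ k) p := hζ.pow (pow_pos hp.pos _) (pow_succ p k)
  have hωu := hω.isUnit_unit hp.ne_zero
  set ω := (hω.isUnit hp.ne_zero).unit
  have hωval : (ω : F) = ζ ^ p ^ k := rfl
  let ρ : Gal(K/F) →* Fˣ := MonoidHom.mk' (fun σ => ω ^ (χ σ).toAdd.val) fun σ τ => by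
    rw [← pow_add, map_mul, toAdd_mul, hωu.pow_eq_pow_iff_natCast_eq hp.ne_zero]
    simp
  have hρ : IsOpen (ρ.ker : Set Gal(K/F)) := by
    refine Subgroup.isOpen_mono (fun σ hσ => ?_) hχ
    rw [MonoidHom.mem_ker] at hσ ⊢
    change ω ^ (χ σ).toAdd.val = 1
    rw [hσ]; simp
  obtain ⟨β, hβ0, hβ⟩ := exists_forall_apply_eq_character_mul ρ hρ
  set z : K := algebraMap F K ζ with hz
  have hζK : IsPrimitiveRoot z (p ^ (k + 1)) := hζ.map_of_injective (algebraMap F K).injective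
  have hne : NeZero ((p ^ (k + 1) : ℕ) : K) := hζK.neZero'
  have : NeZero ((p ^ k : ℕ) : K) := ⟨fun h => hne.out (by
    rw [pow_succ, Nat.cast_mul, h, zero_mul])⟩
  -- The root exists because a primitive root of unity of order p^(k+1) makes `p` invertible. The
  -- exponents of σα/α as powers of `z` define `ψ`; it is additive because ζ lies in `F`.
  obtain ⟨α, hα⟩ := IsSepClosed.exists_pow_nat_eq β (p ^ k)
  have hα0 : α ≠ 0 := by
    rintro rfl
    rw [zero_pow (pow_pos hp.pos k).ne'] at hα
    exact hβ0 hα.symm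
  have hσα : ∀ σ : Gal(K/F), (σ α / α) ^ p ^ k = (z ^ p ^ k) ^ (χ σ).toAdd.val := fun σ => by
    rw [div_pow, ← map_pow, hα, hβ, mul_div_cancel_right₀ _ hβ0]
    simp [ρ, hωval, hz]
  have hex : ∀ σ : Gal(K/F), ∃ i : ℕ, σ α = z ^ i * α := fun σ => by
    obtain ⟨i, -, hi⟩ := hζK.eq_pow_of_pow_eq_one (ξ := σ α / α) (by
      rw [pow_succ, pow_mul, hσα, ← pow_mul, mul_comm _ p, pow_mul (z ^ p ^ k), ← pow_mul z, ← pow_succ p,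
        hζK.pow_eq_one, one_pow])
    exact ⟨i, by rw [hi, div_mul_cancel₀ _ hα0]⟩
  choose i hi using hex
  have hmod : ∀ a b : ℕ, z ^ a = z ^ b ↔ (a : ZMod (p ^ (k + 1))) = b := 
    hζK.pow_eq_pow_iff_natCast_eq (pow_pos hp.pos _).ne'
  let ψ : Gal(K/F) →* Multiplicative (ZMod (p ^ (k + 1))) :=
    MonoidHom.mk' (fun σ => Multiplicative.ofAdd (i σ : ZMod (p ^ (k + 1)))) fun σ τ => by
      rw [← ofAdd_add, ← Nat.cast_add]
      congr 1
      rw [← hmod]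
      apply mul_right_cancel₀ hα0
      rw [← hi, AlgEquiv.mul_apply, hi τ, map_mul, map_pow, hz, AlgEquiv.commutes, hi σ, pow_add]
      ring
  refine ⟨ψ, ?_, fun σ => ?_⟩
  · refine Subgroup.isOpen_mono (fun σ hσ => ?_) (stabilizer_isOpen_of_isIntegral α)
    rw [MulAction.mem_stabilizer_iff, AlgEquiv.smul_def, hi] at hσ
    have h1 : z ^ i σ = z ^ 0 := mul_right_cancel₀ hα0 (by rw [hσ, pow_zero, one_mul])
    rw [hmod, Nat.cast_zero] at h1
    rw [MonoidHom.mem_ker]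
    change Multiplicative.ofAdd (i σ : ZMod (p ^ (k + 1))) = 1
    rw [h1, ofAdd_zero]
  · change ZMod.castHom _ (ZMod p) (i σ : ZMod (p ^ (k + 1))) = _
    have hωK : IsPrimitiveRoot (z ^ p ^ k) p := hζK.pow (pow_pos hp.pos _) (pow_succ p k)
    have h1 := hσα σ
    rw [hi, mul_div_cancel_right₀ _ hα0, ← pow_mul, mul_comm, pow_mul,
      hωK.pow_eq_pow_iff_natCast_eq hp.ne_zero, ZMod.natCast_zmod_val] at h1
    rw [map_natCast, h1]

/-! ### The maximal pro-p quotient and its abelianization -/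

instance QuotientGroup.nonarchimedeanGroup {G : Type*} [Group G] [TopologicalSpace G]
    [NonarchimedeanGroup G] (N : Subgroup G) [N.Normal] : NonarchimedeanGroup (G ⧸ N) where
  is_nonarchimedean V hV := by
    obtain ⟨U, hU⟩ := NonarchimedeanGroup.is_nonarchimedean ((QuotientGroup.mk' N) ⁻¹' V)
      (QuotientGroup.continuous_mk.continuousAt.preimage_mem_nhds (by simpa using hV))
    refine ⟨⟨U.toSubgroup.map (QuotientGroup.mk' N), ?_⟩, ?_⟩
    · exact QuotientGroup.isOpenMap_coe _ U.isOpen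
    · rintro _ ⟨g, hg, rfl⟩
      exact hU hg

instance Additive.nonarchimedeanAddGroup {G : Type*} [Group G] [TopologicalSpace G]
    [NonarchimedeanGroup G] : NonarchimedeanAddGroup (Additive G) where
  is_nonarchimedean V hV := by
    obtain ⟨U, hU⟩ := NonarchimedeanGroup.is_nonarchimedean (Additive.ofMul ⁻¹' V) hV
    exact ⟨⟨U.toSubgroup.toAddSubgroup, U.isOpen⟩, hU⟩

instance krullTopology_nonarchimedeanGroup (K L : Type*) [Field K] [Field L] [Algebra K L] :
    NonarchimedeanGroup Gal(L/K) where
  is_nonarchimedean V hV := by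
    obtain ⟨E, hE, hEV⟩ := (krullTopology_mem_nhds_one_iff K L V).1 hV
    exact ⟨⟨E.fixingSubgroup, E.fixingSubgroup_isOpen⟩, hEV⟩

section
variable {G : Type*} [Group G] [TopologicalSpace G]

/-- Every open set containing the pro-`p` kernel of a compact group contains all
`p ^ n`-th powers for some `n`. -/
lemma exists_forall_pow_mem_of_proPKernel_subset [IsTopologicalGroup G] [CompactSpace G] (p : ℕ)
    {V : Set G} (hV : IsOpen V) (h : (proPKernel p G : Set G) ⊆ V) :
    ∃ n, ∀ g : G, g ^ p ^ n ∈ V := by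
  classical
  rw [proPKernel, Subgroup.coe_iInf] at h
  -- By compactness finitely many of the subgroups already intersect inside `V`; the sum of their
  -- index exponents works.
  obtain ⟨t, ht⟩ := hV.isClosed_compl.isCompact.elim_finite_subfamily_closed _
    (fun U : {U : OpenNormalSubgroup G // ∃ n : ℕ, (U : Subgroup G).index = p ^ n} =>
      Subgroup.isClosed_of_isOpen _ U.1.isOpen') (by
    rw [← Set.disjoint_iff_inter_eq_empty]
    exact Set.disjoint_left.2 fun x hx hx' => hx (h hx'))
  choose n hn using fun U : {U : OpenNormalSubgroup G // ∃ n : ℕ, (U : Subgroup G).index = p ^ n} =>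
    U.2
  refine ⟨∑ U ∈ t, n U, fun g => ?_⟩
  by_contra hg
  refine Set.notMem_empty (g ^ p ^ ∑ U ∈ t, n U) (ht ▸ ⟨hg, Set.mem_iInter₂.2 fun U hU => ?_⟩)
  rw [← Finset.add_sum_erase t n hU, pow_add, pow_mul]
  refine Subgroup.pow_mem _ ?_ _
  rw [← hn U]
  have := U.1.isNormal'
  exact Subgroup.pow_index_mem _ g

/-- The projection from `G` to the abelianization of its maximal pro-`p` quotient. -/
def toProPAb (p : ℕ) (G : Type*) [Group G] [TopologicalSpace G] [IsTopologicalGroup G] :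
    G →* TopologicalAbelianization (MaximalProPQuotient p G) :=
  (QuotientGroup.mk' _).comp (QuotientGroup.mk' _)

lemma toProPAb_surjective [IsTopologicalGroup G] (p : ℕ) : Function.Surjective (toProPAb p G) :=
  (QuotientGroup.mk'_surjective _).comp (QuotientGroup.mk'_surjective _)

lemma toProPAb_continuous [IsTopologicalGroup G] (p : ℕ) : Continuous (toProPAb p G) :=
  QuotientGroup.continuous_mk.comp QuotientGroup.continuous_mk

lemma proPKernel_le_ker_of_isOpen {p n : ℕ} [Fact p.Prime]
    (ψ : G →* Multiplicative (ZMod (p ^ n))) (hψ : IsOpen (ψ.ker : Set G)) :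
    proPKernel p G ≤ ψ.ker := by
  have hidx : ∃ m, ψ.ker.index = p ^ m := by
    have h : ψ.ker.index ∣ p ^ n := by
      rw [Subgroup.index_ker]
      simpa using Subgroup.card_subgroup_dvd_card ψ.range
    obtain ⟨m, -, hm⟩ := (Nat.dvd_prime_pow Fact.out).1 h
    exact ⟨m, hm⟩
  exact iInf_le (fun U : {U : OpenNormalSubgroup G // ∃ n : ℕ, (U : Subgroup G).index = p ^ n} =>
    (U.1 : Subgroup G)) ⟨⟨⟨ψ.ker, hψ⟩, inferInstance⟩, hidx⟩

/-- The kernel is open of p-power index, and closed with abelian quotient, so `ψ` descends through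
both quotients. -/
lemma exists_zmodHom_proPAb_of_isOpen_ker [IsTopologicalGroup G] {p n : ℕ} [Fact p.Prime]
    (ψ : G →* Multiplicative (ZMod (p ^ n))) (hψ : IsOpen (ψ.ker : Set G)) :
    ∃ f : Additive (TopologicalAbelianization (MaximalProPQuotient p G)) →L[ℤ] ZMod (p ^ n),
      ∀ g, f (Additive.ofMul (toProPAb p G g)) = (ψ g).toAdd := by
  have hcont : Continuous ψ := by
    apply continuous_of_continuousAt_one ψ
    rw [ContinuousAt, map_one, nhds_discrete (Multiplicative (ZMod (p ^ n))), Filter.tendsto_pure]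
    filter_upwards [hψ.mem_nhds (one_mem ψ.ker)] with g hg using hg
  let ψ₁ : MaximalProPQuotient p G →* Multiplicative (ZMod (p ^ n)) :=
    QuotientGroup.lift _ ψ (proPKernel_le_ker_of_isOpen ψ hψ)
  have hcont₁ : Continuous ψ₁ := QuotientGroup.isOpenQuotientMap_mk.isQuotientMap.continuous_iff.2 hcont
  let ψ₂ : TopologicalAbelianization (MaximalProPQuotient p G) →* Multiplicative (ZMod (p ^ n)) :=
    QuotientGroup.lift _ ψ₁ (Subgroup.topologicalClosure_minimal _
      (Abelianization.commutator_subset_ker ψ₁) (isClosed_singleton.preimage hcont₁))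
  have hcont₂ : Continuous ψ₂ := QuotientGroup.isOpenQuotientMap_mk.isQuotientMap.continuous_iff.2 hcont₁
  exact ⟨⟨(MonoidHom.toAdditiveLeft ψ₂).toIntLinearMap, hcont₂⟩, fun g => rfl⟩

end

/-- Multiplicative form of `exists_bijective_hom_prod`. -/
theorem exists_continuousMulEquiv_prod (A : Type u) [CommGroup A] [TopologicalSpace A]
    [NonarchimedeanGroup A] [CompactSpace A] [T2Space A] (p : ℕ) [Fact p.Prime]
    (hA : ∀ U : Set A, IsOpen U → 1 ∈ U → ∃ n, ∀ a : A, a ^ p ^ n ∈ U)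
    (htor : IsClosed (CommGroup.torsion A : Set A))
    (k : ℕ) (hk : ∀ χ : Additive A →L[ℤ] ZMod p, χ ∈ liftableHoms (Additive A) p k ∅) :
    ∃ (J : Type u) (l : ℕ) (m : Fin l → Type u) (s : Fin l → ℕ),
      StrictMono s ∧ (∀ i, k + 1 ≤ s i) ∧
      Nonempty (A ≃ₜ* Multiplicative ((J → ℤ_[p]) × ((i : Fin l) → m i → ZMod (p ^ s i)))) := by
  have : T2Space (Additive A) := ‹T2Space A›
  obtain ⟨J, l, m, s, hs, hks, Φ, hΦ⟩ := exists_bijective_hom_prod (Additive A) p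
    (fun U => hA (Additive.ofMul ⁻¹' (U : Set (Additive A))) U.isOpen U.zero_mem)
    (Subgroup.toAddSubgroup (CommGroup.torsion A)) htor
    (fun b => isOfFinAddOrder_ofMul_iff.symm) k hk
  refine ⟨J, l, m, s, hs, hks, ⟨?_⟩⟩
  let e : Additive A ≃+ (J → ℤ_[p]) × ((i : Fin l) → m i → ZMod (p ^ s i)) :=
    AddEquiv.ofBijective Φ hΦ
  have he : Continuous e := Φ.continuous
  exact
    { AddEquiv.toMultiplicativeRight e with
      continuous_toFun := he
      continuous_invFun := he.continuous_symm_of_equiv_compact_to_t2 (f := e.toEquiv) }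

lemma exists_forall_pow_mem_proPAb {G : Type*} [Group G] [TopologicalSpace G]
    [IsTopologicalGroup G] [CompactSpace G] (p : ℕ)
    (U : Set (TopologicalAbelianization (MaximalProPQuotient p G))) (hU : IsOpen U) (h1 : 1 ∈ U) :
    ∃ n, ∀ a, a ^ p ^ n ∈ U := by
  obtain ⟨n, hn⟩ := exists_forall_pow_mem_of_proPKernel_subset p
    (hU.preimage (toProPAb_continuous p)) fun g hg => by
      have h2 : QuotientGroup.mk' (proPKernel p G) g = 1 := (QuotientGroup.eq_one_iff g).2 hg
      rwa [Set.mem_preimage, toProPAb, MonoidHom.comp_apply, h2, map_one]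
  refine ⟨n, fun a => ?_⟩
  obtain ⟨g, rfl⟩ := toProPAb_surjective p a
  rw [← map_pow]
  exact hn g

/-- Inflate the character to the absolute Galois group, lift it there by Kummer theory, and descend
the lift. -/
lemma mem_liftableHoms_proPAb {p k : ℕ} [Fact p.Prime] {F : Type*} [Field F] {ζ : F}
    (hζ : IsPrimitiveRoot ζ (p ^ (k + 1)))
    (χ : Additive (maximalProPGaloisGroupAb p F) →L[ℤ] ZMod p) :
    χ ∈ liftableHoms (Additive (maximalProPGaloisGroupAb p F)) p k ∅ := by
  let χ' : Gal(SeparableClosure F/F) →* Multiplicative (ZMod p) :=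
    MonoidHom.mk' (fun g => Multiplicative.ofAdd (χ (Additive.ofMul (toProPAb p _ g))))
      fun a b => by rw [map_mul, ofMul_mul, map_add, ofAdd_add]
  obtain ⟨ψ, hψ, hψχ⟩ := exists_galois_character_lift hζ χ'
    ((isOpen_discrete {0}).preimage (χ.continuous.comp (toProPAb_continuous p)))
  obtain ⟨f, hf⟩ := exists_zmodHom_proPAb_of_isOpen_ker ψ hψ
  refine ⟨f, by simp, fun b => ?_⟩
  obtain ⟨g, hg⟩ := toProPAb_surjective p b.toMul
  obtain rfl : b = Additive.ofMul (toProPAb p _ g) := hg.symm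
  rw [hf, hψχ]
  rfl

theorem theorem4p6 (p : ℕ) [Fact p.Prime] (F : Type u) [Field F] (k : ℕ) (hk : 1 ≤ k)
    (hζ : ∃ ζ : F, IsPrimitiveRoot ζ (p ^ k))
    (htor : IsClosed (CommGroup.torsion (maximalProPGaloisGroupAb p F) :
      Set (maximalProPGaloisGroupAb p F))) :
    ∃ (J : Type u) (l : ℕ) (m : Fin l → Type u) (s : Fin l → ℕ),
      StrictMono s ∧ (∀ i, k ≤ s i) ∧
      Nonempty (maximalProPGaloisGroupAb p F ≃ₜ*
        Multiplicative ((J → ℤ_[p]) × ((i : Fin l) → m i → ZMod (p ^ s i)))) := by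
  obtain ⟨k, rfl⟩ := Nat.exists_eq_add_of_le' hk
  obtain ⟨ζ, hζ⟩ := hζ
  -- Closedness of the subgroup supplies the Hausdorff property of the quotient.
  have : IsClosed ((commutator (maximalProPGaloisGroup p F)).topologicalClosure :
    Set (maximalProPGaloisGroup p F)) := Subgroup.isClosed_topologicalClosure _
  exact exists_continuousMulEquiv_prod (maximalProPGaloisGroupAb p F) p
    (exists_forall_pow_mem_proPAb p) htor k (mem_liftableHoms_proPAb hζ)
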